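/- Let $S=\{1,\dots,N\}$. For $i\in S$ let $D_i$ be a nonempty subset of $E_i=\{q\in\mathbb R^N: q_j\ge 0 \text{ for } j\ne i,\ q_i=-\sum_{j\neq i}q_j\}$, and let $\mathcal Q$ be the set of all $Q\in\mathbb R^{N\times N}$ whose $i$-th row $Q_i$ lies in $D_i$ for every $i\in S$. For $Q,R\in\mathcal Q$ and $\varepsilon>0$ let $Q\otimes_\varepsilon R$ denote the time-dependent generator that equals $Q$ on $[0,\varepsilon]$ and $R$ on $(\varepsilon,\infty)$; a constant generator $Q$ is the case $R=Q$. Let $X=(X_t)_{t\ge0}$ be an $S$-valued càdlàg process which, under the probability measure $\mathbb P_{i,A}$ (with expectation $\mathbb E_{i,A}$), is a continuous-time Markov chain started at $i$ with generator $A$, for each $i\in S$ and each such generator $A=(A(t))_{t\ge0}$. Let $f(t,i,q)\in\mathbb R$ ($t\ge0$, $i\in S$, $q\in D_i$) be a payoff function such that $f(\cdot,i,q)$ is continuous on $[0,\infty)$ for all $i\in S$, $q\in D_i$, and $f(t,i,\cdot)$ is continuous on $D_i$ for all $t\ge 0$, $i\in S$. Set $$F(i,A)=\mathbb E_{i,A}\Big[\int_0^\infty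 f\big(t,X_t,A(t)_{X_t}\big)\,dt\Big],$$ where $A(t)_j$ is the $j$-th row of $A(t)$. A matrix $Q^*\in\mathcal Q$ is a *weak equilibrium* if $$\liminf_{\varepsilon\downarrow0}\frac{F(i,Q^*)-F(i,Q\otimes_\varepsilon Q^*)}{\varepsilon}\ge0\qquad\text{for all } Q\in\mathcal Q,\ i\in S,$$ and a *strong equilibrium* if for all $i\in S$ and $Q\in\mathcal Q$ there is $\varepsilon>0$ such that $F(i,Q^*)\ge F(i,Q\otimes_{\varepsilon'}Q^*)$ for all $0<\varepsilon'\le\varepsilon$. A function $g(t,i,q)$ is said to satisfy condition (I) if $$\int_0^\infty\sup\{|g(t,i,q)|: i\in S,\ q\in D_i,\ \|q\|\le c\}\,dt<\infty\quad\text{for all } c>0,$$ with $\|\cdot\|$ the Euclidean norm. **Theorem.** Suppose that each $D_i$ is convex and compact, that $f$ satisfies (I), and that $f(0,i,\cdot)$ is concave on $D_i$ for every $i\in S$. Then a weak equilibrium exists. Suppose in addition that $f(0,i,\cdot)$ is strictly concave on $D_i$ for every $i\in S$, that $f(\cdot,i,q)$ is $C^1$ on $[0,\infty)$ for all $i\in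 S$, $q\in D_i$, that the time derivative $f_t$ satisfies (I), and that there is a function $r(t,\varepsilon;i,q)$ such that, for all $t\ge0$, $\varepsilon>0$, $i\in S$, $q\in D_i$, $$|f(t+\varepsilon,i,q)-(f(t,i,q)+\varepsilon f_t(t,i,q))|\le r(t,\varepsilon;i,q),$$ where, for all $(t,i,q)$, $r(t,\varepsilon;i,q)$ is continuous in $\varepsilon>0$ and $r(t,\varepsilon;i,q)/\varepsilon$ is nondecreasing in $\varepsilon>0$, and, for all $(i,q)$, $\int_0^\infty r(t,\varepsilon;i,q)\,dt<\infty$ for all sufficiently small $\varepsilon>0$. Then a strong equilibrium exists. -/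

import Mathlib

open MeasureTheory Set Filter Topology

namespace EquilibriumControl

/-- The set `E i` of all possible `i`-th rows of a generator on the state space `Fin N`:
nonnegative off-diagonal rates, and a diagonal entry that makes the row sum to zero. -/
def generatorRows {N : ℕ} (i : Fin N) : Set (Fin N → ℝ) :=
  {q | (∀ j, j ≠ i → 0 ≤ q j) ∧ q i = -∑ j ∈ Finset.univ.erase i, q j}

/-- The control space: the matrices whose `i`-th row lies in the admissible set `D i`. -/
def controlSpace {N : ℕ} (D : Fin N → Set (Fin N → ℝ)) : Set (Matrix (Fin N) (Fin N) ℝ) :=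
  {Q | ∀ i, Q i ∈ D i}

/-- The concatenation of `Q` and `R` at time `ε`, as a time-dependent generator:
`Q` up to and including time `ε`, and `R` afterwards. -/
noncomputable def concat {N : ℕ} (Q : Matrix (Fin N) (Fin N) ℝ) (ε : ℝ)
    (R : Matrix (Fin N) (Fin N) ℝ) : ℝ → Matrix (Fin N) (Fin N) ℝ :=
  fun t => if t ≤ ε then Q else R

/-- The sigma-algebra generated by `X u`, `0 ≤ u ≤ s`. -/
@[reducible] def history {N : ℕ} {Ω : Type*} (X : ℝ → Ω → Fin N) (s : ℝ) : MeasurableSpace Ω :=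
  ⨆ u ∈ Icc (0 : ℝ) s, MeasurableSpace.comap (X u) ⊤

/-- Under `P`, the process `(X t)`, `t ≥ 0`, is a càdlàg continuous-time Markov chain with values in
`Fin N`, started at `i`, whose generator at time `t` is `A t`, where `A` is piecewise constant (only
nonnegative times matter). The law is given by the Markov property with the transition matrix
`exp ((t - s) Q)` on every time interval `(s, t]` on which the generator is constantly `Q`. For `A`
constant this is the time-homogeneous chain with that generator; for `A = concat Q ε R` it is the
chain that is governed by `Q` on `[0, ε]` and by `R` on `(ε, ∞)`. -/
structure IsMarkovChain {N : ℕ} {Ω : Type*} [MeasurableSpace Ω] (X : ℝ → Ω → Fin N)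
    (P : Measure Ω) (i : Fin N) (A : ℝ → Matrix (Fin N) (Fin N) ℝ) : Prop where
  isProbabilityMeasure : IsProbabilityMeasure P
  measurable : ∀ t, 0 ≤ t → Measurable (X t)
  right_continuous : ∀ ω t, 0 ≤ t → ContinuousWithinAt (fun u => X u ω) (Ici t) t
  left_limit : ∀ ω t, 0 < t → ∃ j, Tendsto (fun u => X u ω) (𝓝[<] t) (𝓝 j)
  initial : ∀ᵐ ω ∂P, X 0 ω = i
  markov : ∀ (s t : ℝ) (Q : Matrix (Fin N) (Fin N) ℝ), 0 ≤ s → s ≤ t →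
    (∀ u ∈ Ioc s t, A u = Q) →
    ∀ B, MeasurableSet[history X s] B → ∀ j k : Fin N,
      P.real (B ∩ {ω | X s ω = j ∧ X t ω = k}) =
        P.real (B ∩ {ω | X s ω = j}) * NormedSpace.exp ((t - s) • Q) j k

/-- A controlled chain: a process `X` with laws `P i A` such that, for every starting state `i` and
all `Q, R` in the control space and `ε > 0`, the process is under `P i A` a Markov chain started at
`i` with generator `A = concat Q ε R`. The case `Q = R` is the constant generator `Q`. -/
def IsControlledChain {N : ℕ} (D : Fin N → Set (Fin N → ℝ)) {Ω : Type*} [MeasurableSpace Ω]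
    (X : ℝ → Ω → Fin N) (P : Fin N → (ℝ → Matrix (Fin N) (Fin N) ℝ) → Measure Ω) : Prop :=
  ∀ i, ∀ Q ∈ controlSpace D, ∀ R ∈ controlSpace D, ∀ ε > 0,
    IsMarkovChain X (P i (concat Q ε R)) i (concat Q ε R)

/-- The expected payoff `𝔼_{i,A} [∫₀^∞ f(t, X_t, (A t)_{X_t}) dt]`. -/
noncomputable def payoff {N : ℕ} (f : ℝ → Fin N → (Fin N → ℝ) → ℝ) {Ω : Type*}
    [MeasurableSpace Ω] (X : ℝ → Ω → Fin N)
    (P : Fin N → (ℝ → Matrix (Fin N) (Fin N) ℝ) → Measure Ω)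
    (i : Fin N) (A : ℝ → Matrix (Fin N) (Fin N) ℝ) : ℝ :=
  ∫ ω, (∫ t in Ioi (0 : ℝ), f t (X t ω) (A t (X t ω))) ∂(P i A)

/-- `∫₀^∞ sup {|f(t,i,q)| : i, q ∈ D i, ‖q‖ ≤ c} dt < ∞` for all `c > 0`, with the Euclidean
norm of `q`. -/
def IntegrabilityCondition {N : ℕ} (D : Fin N → Set (Fin N → ℝ))
    (f : ℝ → Fin N → (Fin N → ℝ) → ℝ) : Prop :=
  ∀ c > 0, ∫⁻ t in Ioi (0 : ℝ),
    (⨆ (i : Fin N) (q ∈ D i) (_ : ‖WithLp.toLp 2 q‖ ≤ c), ENNReal.ofReal |f t i q|) < ⊤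

/-- The time derivative of `f` on `[0, ∞)` (one-sided at `0`). -/
noncomputable def timeDeriv {N : ℕ} (f : ℝ → Fin N → (Fin N → ℝ) → ℝ) :
    ℝ → Fin N → (Fin N → ℝ) → ℝ :=
  fun t i q => derivWithin (fun s => f s i q) (Ici 0) t

/-- The smoothness conditions on `f` for a second-order expansion: `f` is `C¹` in time, its time
derivative satisfies the integrability condition, and the first-order Taylor remainder in time is
bounded by some `r(t,ε;i,q)` that is continuous in `ε`, integrable in `t` for small `ε`, and such
that `r / ε` is increasing in `ε`. -/
structure SecondOrderCondition {N : ℕ} (D : Fin N → Set (Fin N → ℝ))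
    (f : ℝ → Fin N → (Fin N → ℝ) → ℝ) : Prop where
  integrability : IntegrabilityCondition D f
  contDiffOn : ∀ i, ∀ q ∈ D i, ContDiffOn ℝ 1 (fun t => f t i q) (Ici 0)
  integrability_timeDeriv : IntegrabilityCondition D (timeDeriv f)
  remainder : ∃ r : ℝ → ℝ → Fin N → (Fin N → ℝ) → ℝ,
    (∀ t ≥ 0, ∀ ε > 0, ∀ i, ∀ q ∈ D i,
      |f (t + ε) i q - (f t i q + ε * timeDeriv f t i q)| ≤ r t ε i q) ∧
    (∀ t ≥ 0, ∀ i, ∀ q ∈ D i, ContinuousOn (fun ε => r t ε i q) (Ioi 0)) ∧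
    (∀ i, ∀ q ∈ D i, ∃ ε₀ > 0, ∀ ε ∈ Ioo 0 ε₀,
      IntegrableOn (fun t => r t ε i q) (Ioi 0)) ∧
    (∀ t ≥ 0, ∀ i, ∀ q ∈ D i, MonotoneOn (fun ε => r t ε i q / ε) (Ioi 0))

/-- `Qs` is a weak equilibrium: the lower limit, as `ε ↓ 0`, of
`(F(i,Qs) - F(i, Q ⊗_ε Qs)) / ε` is nonnegative for all states `i` and controls `Q`. The lower
limit is taken in the extended reals. -/
def IsWeakEquilibrium {N : ℕ} (D : Fin N → Set (Fin N → ℝ))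
    (f : ℝ → Fin N → (Fin N → ℝ) → ℝ) {Ω : Type*} [MeasurableSpace Ω] (X : ℝ → Ω → Fin N)
    (P : Fin N → (ℝ → Matrix (Fin N) (Fin N) ℝ) → Measure Ω)
    (Qs : Matrix (Fin N) (Fin N) ℝ) : Prop :=
  Qs ∈ controlSpace D ∧ ∀ Q ∈ controlSpace D, ∀ i,
    (0 : EReal) ≤ liminf
      (fun ε : ℝ =>
        (((payoff f X P i (fun _ => Qs) - payoff f X P i (concat Q ε Qs)) / ε : ℝ) : EReal))
      (𝓝[>] 0)

/-- `Qs` is a strong equilibrium: for all states `i` and controls `Q`, deviating to `Q` on `[0, ε']`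
does not increase the payoff, for all sufficiently small `ε' > 0`. -/
def IsStrongEquilibrium {N : ℕ} (D : Fin N → Set (Fin N → ℝ))
    (f : ℝ → Fin N → (Fin N → ℝ) → ℝ) {Ω : Type*} [MeasurableSpace Ω] (X : ℝ → Ω → Fin N)
    (P : Fin N → (ℝ → Matrix (Fin N) (Fin N) ℝ) → Measure Ω)
    (Qs : Matrix (Fin N) (Fin N) ℝ) : Prop :=
  Qs ∈ controlSpace D ∧ ∀ i, ∀ Q ∈ controlSpace D, ∃ ε > 0, ∀ ε', 0 < ε' → ε' ≤ ε →
    payoff f X P i (concat Q ε' Qs) ≤ payoff f X P i (fun _ => Qs)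

end EquilibriumControl

open EquilibriumControl

/-! ### Brouwer's theorem via volumes of perturbed balls. -/

section Brouwer

open scoped NNReal RealInnerProductSpace
open Module

/-! Let `V R` be the vector of payoffs of a constant control `R`. Deviating to `Q` on `[0, ε]` costs
exactly the integral over `[0, ε]` of `exp (t Q)` applied to the advantage of `R` over `Q` at time
`t` (`payoff_sub_payoff_concat`). At `t = 0` the `i`-th advantage is a difference of Hamiltonians `q
↦ f 0 i q + q ⬝ᵥ V R`, taken at `R i` and at `Q i`. It therefore suffices to find `R` each of whose
rows maximizes the Hamiltonian formed with its own payoffs `V R`.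

Such an `R` comes from Ky Fan's inequality, applied to the sum over states of the Hamiltonian gains:
this sum is concave in the deviation, vanishes on the diagonal, and is continuous in `R` because `V`
is (dominated convergence). Ky Fan follows from Brouwer's theorem, proved here from the
impossibility of a `C¹` retraction of a ball onto its sphere.

One `R` serves both claims. Maximality makes the derivative of the loss at `ε = 0` nonnegative,
which is the weak property. Under strict concavity the advantage at time `0` is positive in each
state where `Q` and `R` differ, and it vanishes at all times in the others. By continuity the whole
advantage vector is nonnegative for small `t`; the entries of `exp (t Q)` are nonnegative, so the
loss is too. -/

/-- Evaluation at `1` of the polynomials of degree at most `n` is a fixed linear combination of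
evaluations at nodes in `(0, δ)`. -/
theorem exists_interpolation_weights (n : ℕ) {δ : ℝ} (hδ : 0 < δ) :
    ∃ t w : Fin (n + 1) → ℝ, (∀ k, t k ∈ Ioo 0 δ) ∧
      ∀ p : Polynomial ℝ, p.natDegree ≤ n → p.eval 1 = ∑ k, w k * p.eval (t k) := by
  let t : Fin (n + 1) → ℝ := fun k => δ * ((k + 1) / (n + 2))
  have ht : InjOn t (Finset.univ : Finset (Fin (n + 1))) := by
    intro a _ b _ hab
    have h2 : (n + 2 : ℝ) ≠ 0 := by positivity
    have : ((a : ℕ) : ℝ) = (b : ℕ) := by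
      simp only [t] at hab
      field_simp at hab
      linarith
    exact Fin.ext (by exact_mod_cast this)
  refine ⟨t, fun k => (Lagrange.basis Finset.univ t k).eval 1, fun k => ⟨by positivity, ?_⟩, ?_⟩
  · have hk : ((k : ℕ) : ℝ) + 1 ≤ n + 1 := by exact_mod_cast k.2
    have : ((k : ℕ) + 1 : ℝ) / (n + 2) < 1 := by
      rw [div_lt_one (by positivity)]; linarith
    exact mul_lt_of_lt_one_right hδ this
  · intro p hp
    have hdeg : p.degree < (Finset.univ : Finset (Fin (n + 1))).card := by
      rw [Finset.card_univ, Fintype.card_fin]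
      exact (Polynomial.degree_le_of_natDegree_le hp).trans_lt (by exact_mod_cast Nat.lt_succ_self n)
    conv_lhs => rw [Lagrange.eq_interpolate ht hdeg]
    rw [Lagrange.interpolate_apply, Polynomial.eval_finsetSum]
    simp [mul_comm]

theorem exists_polynomial_det_id_add_smul {E : Type*} [NormedAddCommGroup E] [NormedSpace ℝ E]
    [FiniteDimensional ℝ E] (A : E →L[ℝ] E) :
    ∃ p : Polynomial ℝ, p.natDegree ≤ finrank ℝ E ∧
      ∀ t : ℝ, p.eval t = (ContinuousLinearMap.id ℝ E + t • A).det := by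
  let b := finBasis ℝ E
  let M := LinearMap.toMatrix b b (A : E →ₗ[ℝ] E)
  refine ⟨Matrix.det ((Polynomial.X : Polynomial ℝ) • M.map Polynomial.C +
    (1 : Matrix _ _ ℝ).map Polynomial.C), ?_, fun t => ?_⟩
  · simpa using Polynomial.natDegree_det_X_add_C_le M 1
  · rw [← Polynomial.coe_evalRingHom, RingHom.map_det, ContinuousLinearMap.det,
      ← LinearMap.det_toMatrix b]
    congr 1
    ext i j
    simp [M, Matrix.one_apply, LinearMap.toMatrix_apply]
    rw [Finsupp.single_apply]
    by_cases h : i = j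
    · simp [h, mul_comm, add_comm]
    · simp [h, Ne.symm h, mul_comm]

/-- Adding the variational inequalities of the nearest points of `x` and `y` gives `‖π x - π y‖² ≤
⟪x - y, π x - π y⟫`; Cauchy–Schwarz does the rest. -/
theorem exists_lipschitz_projection {E : Type*} [NormedAddCommGroup E] [InnerProductSpace ℝ E]
    [CompleteSpace E] {K : Set E} (hne : K.Nonempty) (hcl : IsClosed K) (hc : Convex ℝ K) :
    ∃ π : E → E, LipschitzWith 1 π ∧ (∀ x, π x ∈ K) ∧
      ∀ x, ∀ w ∈ K, ⟪x - π x, w - π x⟫ ≤ 0 := by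
  choose π hπ hmin using exists_norm_eq_iInf_of_complete_convex hne hcl.isComplete hc
  have hin : ∀ x, ∀ w ∈ K, ⟪x - π x, w - π x⟫ ≤ 0 := fun x =>
    (norm_eq_iInf_iff_real_inner_le_zero hc (hπ x)).1 (hmin x)
  refine ⟨π, LipschitzWith.of_dist_le_mul fun x y => ?_, hπ, hin⟩
  rw [NNReal.coe_one, one_mul, dist_eq_norm, dist_eq_norm]
  have h1 := hin x _ (hπ y)
  have h2 := hin y _ (hπ x)
  have h3 : ⟪x - y, π x - π y⟫ ≤ ‖x - y‖ * ‖π x - π y‖ := real_inner_le_norm _ _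
  have h4 : ‖π x - π y‖ * ‖π x - π y‖ ≤ ⟪x - y, π x - π y⟫ := by
    rw [← real_inner_self_eq_norm_mul_norm]
    simp only [inner_sub_left, inner_sub_right] at *
    linarith [real_inner_comm (π x) (π y)]
  by_contra! h
  nlinarith [norm_nonneg (x - y)]

variable {E : Type*} [NormedAddCommGroup E] [InnerProductSpace ℝ E] [FiniteDimensional ℝ E]

/-- Small multiples of a `C¹` displacement `u` that vanishes on a sphere and whose full
translate maps the ball to itself permute the ball. -/
theorem injOn_and_image_ball_of_small {R : ℝ} (hR : 0 < R) {u : E → E} {L : ℝ≥0}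
    (hL : LipschitzOnWith L u (Metric.closedBall 0 R))
    (hmaps : ∀ x ∈ Metric.closedBall (0 : E) R, x + u x ∈ Metric.closedBall (0 : E) R)
    (hzero : ∀ x, ‖x‖ = R → u x = 0) {t : ℝ} (ht0 : 0 ≤ t) (ht1 : t ≤ 1) (htL : t * L < 1) :
    InjOn (fun x => x + t • u x) (Metric.closedBall 0 R) ∧
      (fun x => x + t • u x) '' Metric.closedBall 0 R = Metric.closedBall 0 R := by
  constructor
  · intro x hx y hy hxy
    have h1 : x - y = t • (u y - u x) := by
      rw [smul_sub, sub_eq_sub_iff_add_eq_add, add_comm (t • u y)]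
      simpa using hxy
    have h2 := hL.norm_sub_le hy hx
    by_contra hne
    have hpos : 0 < ‖x - y‖ := norm_pos_iff.2 (sub_ne_zero.2 hne)
    have h3 : ‖x - y‖ = t * ‖u y - u x‖ := by
      conv_lhs => rw [h1, norm_smul, Real.norm_of_nonneg ht0]
    rw [norm_sub_rev y x] at h2
    nlinarith
  · refine Subset.antisymm ?_ fun y hy => ?_
    · rintro _ ⟨x, hx, rfl⟩
      have := (convex_closedBall (0 : E) R) hx (hmaps x hx) (sub_nonneg.2 ht1) ht0 (by ring)
      convert this using 1
      module
    · obtain ⟨π, hπL, hπB, hπi⟩ := exists_lipschitz_projection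
        (Metric.nonempty_closedBall.2 hR.le : (Metric.closedBall (0 : E) R).Nonempty)
        Metric.isClosed_closedBall (convex_closedBall _ _)
      -- Solving `x + t • u x = y` becomes a fixed point problem on the whole space once `u` is
      -- precomposed with the projection. A solution outside the ball would project to the sphere,
      -- where `u = 0`, and so would equal `y`, which lies in the ball.
      have hcontr : ContractingWith (t.toNNReal * L) (fun x => y - t • u (π x)) := by
        refine ⟨by rw [← NNReal.coe_lt_coe]; simpa [Real.coe_toNNReal t ht0] using htL,
          LipschitzWith.of_dist_le_mul fun a b => ?_⟩
        rw [dist_sub_left, dist_smul₀, Real.norm_of_nonneg ht0]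
        have h1 := hL.dist_le_mul _ (hπB a) _ (hπB b)
        have h2 := hπL.dist_le_mul a b
        simp only [NNReal.coe_one, one_mul] at h2
        calc t * dist (u (π a)) (u (π b)) ≤ t * (L * dist a b) := by
              gcongr
              exact h1.trans (by gcongr)
          _ = _ := by simp [mul_assoc, Real.coe_toNNReal t ht0]
      let x := ContractingWith.fixedPoint _ hcontr
      have hx : y - t • u (π x) = x := hcontr.fixedPoint_isFixedPt
      by_cases hxB : x ∈ Metric.closedBall (0 : E) R
      · have hself : π x = x := by
          have := hπi x x hxB
          rw [real_inner_self_eq_norm_sq] at this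
          have : ‖x - π x‖ = 0 := by nlinarith [norm_nonneg (x - π x)]
          exact (sub_eq_zero.1 (norm_eq_zero.1 this)).symm
        refine ⟨x, hxB, ?_⟩
        rw [hself] at hx
        exact (sub_eq_iff_eq_add.1 hx).symm
      · exfalso
        have hsph : ‖π x‖ = R := by
          refine le_antisymm (by simpa using hπB x) ?_
          by_contra! hlt
          have hd : 0 < ‖x - π x‖ := norm_pos_iff.2 (sub_ne_zero.2 fun h => hxB (h ▸ hπB x))
          -- This step length keeps the point moved from `π x` towards `x` inside the ball,
          -- contradicting the variational inequality if `π x` is interior.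
          set s := (R - ‖π x‖) / ‖x - π x‖ with hs
          have hspos : 0 < s := div_pos (by linarith) hd
          have hw : π x + s • (x - π x) ∈ Metric.closedBall (0 : E) R := by
            rw [mem_closedBall_zero_iff]
            refine (norm_add_le _ _).trans ?_
            rw [norm_smul, Real.norm_of_nonneg hspos.le, hs, div_mul_cancel₀ _ hd.ne']
            linarith
          have := hπi x _ hw
          rw [add_sub_cancel_left, real_inner_smul_right, real_inner_self_eq_norm_sq] at this
          have : 0 < s * ‖x - π x‖ ^ 2 := by positivity
          linarith
        rw [hzero _ hsph, smul_zero, sub_zero] at hx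
        exact hxB (hx ▸ hy)

/-- For small `t` the map `x ↦ x + t (r x - x)` permutes the ball, so the integral of its Jacobian
determinant is the volume of the ball. That integral is a polynomial in `t`, hence equals the volume
at `t = 1` as well. But there the determinant is that of the derivative of `r`, which is singular
because `r` takes values in a sphere. -/
theorem not_exists_contDiff_retraction {R : ℝ} (hR : 0 < R) {r : E → E} (hr : ContDiff ℝ 1 r)
    (hnorm : ∀ x, ‖r x‖ = R) (hfix : ∀ x, ‖x‖ = R → r x = x) : False := by
  borelize E
  set B := Metric.closedBall (0 : E) R with hB
  have hBc : IsCompact B := isCompact_closedBall _ _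
  let u : E → E := fun x => r x - x
  have hu : ContDiff ℝ 1 u := hr.sub contDiff_id
  have hu' : Continuous (fderiv ℝ u) := hu.continuous_fderiv one_ne_zero
  obtain ⟨L, hL⟩ : ∃ L : ℝ≥0, LipschitzOnWith L u B := by
    obtain ⟨C, hC⟩ := hBc.exists_bound_of_continuousOn hu'.continuousOn
    refine ⟨C.toNNReal, (convex_closedBall _ _).lipschitzOnWith_of_nnnorm_fderiv_le
      (fun x _ => hu.differentiable one_ne_zero x) fun x hx => ?_⟩
    rw [← NNReal.coe_le_coe, coe_nnnorm]
    exact (hC x hx).trans (Real.le_coe_toNNReal C)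
  have hmaps : ∀ x ∈ B, x + u x ∈ B := fun x _ => by simp [u, B, hnorm]
  have hzero : ∀ x, ‖x‖ = R → u x = 0 := fun x hx => by simp [u, hfix x hx]
  have hdetc : Continuous fun p : ℝ × E =>
      (ContinuousLinearMap.id ℝ E + p.1 • fderiv ℝ u p.2).det :=
    ContinuousLinearMap.continuous_det.comp (by fun_prop)
  have hdet_pos : ∀ᶠ t in 𝓝 (0 : ℝ), ∀ x ∈ B,
      0 < (ContinuousLinearMap.id ℝ E + t • fderiv ℝ u x).det := by
    refine hBc.eventually_forall_of_forall_eventually fun x _ => ?_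
    refine hdetc.continuousAt.eventually (lt_mem_nhds ?_)
    simp [ContinuousLinearMap.det]
  obtain ⟨δ₁, hδ₁, hdet⟩ := Metric.eventually_nhds_iff.1 hdet_pos
  set δ := min δ₁ (min 1 (1 / (L + 1))) with hδdef
  have hδ : 0 < δ := by positivity
  have hvol : ∀ t ∈ Ioo 0 δ,
      ∫ x in B, (ContinuousLinearMap.id ℝ E + t • fderiv ℝ u x).det = volume.real B := by
    intro t ht
    have h1 : t < δ₁ := ht.2.trans_le (min_le_left _ _)
    have h2 : t < 1 := ht.2.trans_le ((min_le_right _ _).trans (min_le_left _ _))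
    have h3 : t < 1 / (L + 1) := ht.2.trans_le ((min_le_right _ _).trans (min_le_right _ _))
    have h4 : t * L < 1 := by
      rw [lt_div_iff₀ (by positivity)] at h3
      nlinarith [ht.1]
    obtain ⟨hinj, himg⟩ := injOn_and_image_ball_of_small hR hL hmaps hzero ht.1.le h2.le h4
    have hder : ∀ x ∈ B, HasFDerivWithinAt (fun x => x + t • u x)
        (ContinuousLinearMap.id ℝ E + t • fderiv ℝ u x) B x := fun x _ =>
      ((hasFDerivAt_id x).add
        ((hu.differentiable one_ne_zero x).hasFDerivAt.const_smul t)).hasFDerivWithinAt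
    have hcv := integral_image_eq_integral_abs_det_fderiv_smul volume
      Metric.isClosed_closedBall.measurableSet hder hinj (fun _ => (1 : ℝ))
    rw [himg] at hcv
    simp only [integral_const, smul_eq_mul, mul_one, measureReal_restrict_apply_univ] at hcv
    rw [hcv]
    refine setIntegral_congr_fun Metric.isClosed_closedBall.measurableSet fun x hx => ?_
    have : 0 < (ContinuousLinearMap.id ℝ E + t • fderiv ℝ u x).det :=
      hdet (by simpa [abs_of_pos ht.1] using h1) x hx
    exact (abs_of_pos this).symm
  -- The determinant has degree at most `finrank ℝ E` in `t`. The weights do not depend on `x`, so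
  -- the identity for the value at `1` can be integrated over the ball.
  obtain ⟨t, w, ht, hw⟩ := exists_interpolation_weights (finrank ℝ E) hδ
  have hpt : ∀ x, (0 : ℝ) = ∑ k, w k * (ContinuousLinearMap.id ℝ E + t k • fderiv ℝ u x).det := by
    intro x
    obtain ⟨p, hp, hpe⟩ := exists_polynomial_det_id_add_smul (fderiv ℝ u x)
    have h := hw p hp
    simp only [hpe, one_smul] at h
    rw [← h]
    have hDr : ContinuousLinearMap.id ℝ E + fderiv ℝ u x = fderiv ℝ r x := by
      have : fderiv ℝ u x = fderiv ℝ r x - ContinuousLinearMap.id ℝ E :=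
        ((hr.differentiable one_ne_zero x).hasFDerivAt.sub (hasFDerivAt_id x)).fderiv
      rw [this]; abel
    rw [hDr]
    -- If the derivative were invertible, some `v` would be sent to `r x`; differentiating the
    -- constant `‖r y‖ ^ 2` along `v` then gives `‖r x‖ ^ 2 = 0`.
    by_contra hne
    have hsurj : Function.Surjective (fderiv ℝ r x) := by
      have := (LinearEquiv.ofIsUnitDet (v := finBasis ℝ E) (v' := finBasis ℝ E)
        (f := (fderiv ℝ r x : E →ₗ[ℝ] E)) (by
          rw [LinearMap.det_toMatrix]; exact isUnit_iff_ne_zero.2 (Ne.symm hne))).surjective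
      exact this
    obtain ⟨v, hv⟩ := hsurj (r x)
    have hconst : HasFDerivAt (fun y => ‖r y‖ ^ 2) (0 : E →L[ℝ] ℝ) x := by
      simp only [hnorm]; exact hasFDerivAt_const _ _
    have hn := (hr.differentiable one_ne_zero x).hasFDerivAt.norm_sq
    have := congrArg (fun l => l v) (hn.unique hconst)
    simp [hv, hnorm, hR.ne'] at this
  have hsum : (∑ k, w k) = 1 := by
    have := hw 1 (by simp)
    simpa using this.symm
  have hint : ∀ k, IntegrableOn
      (fun x => (ContinuousLinearMap.id ℝ E + t k • fderiv ℝ u x).det) B volume := fun k =>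
    ((hdetc.comp (Continuous.prodMk_right (t k))).continuousOn).integrableOn_compact hBc
  have : (0 : ℝ) = volume.real B := by
    calc (0 : ℝ) = ∫ x in B, (0 : ℝ) := by simp
      _ = ∫ x in B, ∑ k, w k * (ContinuousLinearMap.id ℝ E + t k • fderiv ℝ u x).det := by
          simp_rw [← hpt]
      _ = ∑ k, w k * volume.real B := by
          rw [integral_finsetSum _ fun k _ => (hint k).const_mul _]
          refine Finset.sum_congr rfl fun k _ => ?_
          rw [integral_const_mul, hvol _ (ht k)]
      _ = volume.real B := by rw [← Finset.sum_mul, hsum, one_mul]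
  have hpos : 0 < volume.real B :=
    ENNReal.toReal_pos (Metric.measure_closedBall_pos _ _ hR).ne' hBc.measure_lt_top.ne
  linarith

/-- A continuous vector field that is the identity outside a ball has a zero. -/
theorem exists_zero_of_eq_id_outside {R : ℝ} (hR : 0 < R) {v : E → E} (hv : Continuous v)
    (hout : ∀ x, R ≤ ‖x‖ → v x = x) : ∃ x, v x = 0 := by
  by_contra! hne
  obtain ⟨ε, hε, hεv⟩ : ∃ ε > 0, ∀ x ∈ Metric.closedBall (0 : E) R, ε ≤ ‖v x‖ := by
    obtain ⟨x₀, -, hx₀⟩ := (isCompact_closedBall (0 : E) R).exists_isMinOn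
      (Metric.nonempty_closedBall.2 hR.le) hv.norm.continuousOn
    exact ⟨_, norm_pos_iff.2 (hne x₀), fun x hx => hx₀ hx⟩
  -- A partition of unity yields a `C¹` map `G` that is `ε`-close to `x - v x` and vanishes outside
  -- the ball. Then `x - G x` has no zero and fixes the sphere, so normalizing it produces a
  -- retraction.
  obtain ⟨G, hG⟩ := exists_contMDiffMap_forall_mem_convex_of_local_const (n := 1)
    (modelWithCornersSelf ℝ E) (t := fun x => {y : E | ‖y - (x - v x)‖ < ε ∧ (R < ‖x‖ → y = 0)})
    (fun x => by
      have : {y : E | ‖y - (x - v x)‖ < ε ∧ (R < ‖x‖ → y = 0)} =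
          Metric.ball (x - v x) ε ∩ {y | R < ‖x‖ → y = 0} := by
        ext y; simp [dist_eq_norm]
      rw [this]
      refine (convex_ball _ _).inter ?_
      by_cases h : R < ‖x‖ <;> simp [h, convex_univ, convex_singleton])
    (fun x => by
      have hc : Continuous fun y => y - v y := continuous_id.sub hv
      rcases lt_or_ge ‖x‖ R with h | h
      · refine ⟨x - v x, ?_⟩
        have h1 : ∀ᶠ y in 𝓝 x, ‖y‖ < R := continuous_norm.continuousAt.eventually (gt_mem_nhds h)
        have h2 : ∀ᶠ y in 𝓝 x, dist (y - v y) (x - v x) < ε :=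
          Metric.tendsto_nhds.1 hc.continuousAt ε hε
        filter_upwards [h1, h2] with y hy1 hy2
        refine ⟨?_, fun h => absurd h hy1.not_gt⟩
        rwa [dist_comm, dist_eq_norm] at hy2
      · refine ⟨0, ?_⟩
        have h2 : ∀ᶠ y in 𝓝 x, dist (y - v y) (x - v x) < ε :=
          Metric.tendsto_nhds.1 hc.continuousAt ε hε
        filter_upwards [h2] with y hy2
        refine ⟨?_, fun _ => rfl⟩
        rwa [hout x h, sub_self, dist_comm, dist_eq_norm] at hy2)
  have hGs : ContDiff ℝ 1 G := G.contMDiff.contDiff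
  let g : E → E := fun x => x - G x
  have hgs : ContDiff ℝ 1 g := contDiff_id.sub hGs
  have hg0 : ∀ x, g x ≠ 0 := by
    intro x h0
    have hGx : G x = x := (sub_eq_zero.1 h0).symm
    rcases lt_or_ge R ‖x‖ with h | h
    · have := (hG x).2 h
      rw [hGx] at this
      rw [this, norm_zero] at h
      exact hR.not_gt h
    · have h1 := (hG x).1
      rw [hGx, sub_sub_cancel] at h1
      exact (hεv x (by simpa using h)).not_gt h1
  have hgout : ∀ x, ‖x‖ = R → g x = x := by
    intro x hx
    have hcl : IsClosed {y | G y = 0} := isClosed_eq hGs.continuous continuous_const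
    have : x ∈ closure {y : E | R < ‖y‖} := by
      have hlim : Tendsto (fun s : ℝ => s • x) (𝓝[>] 1) (𝓝 x) := by
        have : Tendsto (fun s : ℝ => s • x) (𝓝 1) (𝓝 ((1 : ℝ) • x)) :=
          (continuous_id.smul continuous_const).tendsto 1
        rw [one_smul] at this
        exact this.mono_left nhdsWithin_le_nhds
      refine mem_closure_of_tendsto hlim ?_
      filter_upwards [self_mem_nhdsWithin] with s hs
      have hs : 1 < s := hs
      simp only [norm_smul, hx, Real.norm_of_nonneg (zero_le_one.trans hs.le)]
      nlinarith
    have : G x = 0 := closure_minimal (fun y hy => (hG y).2 hy) hcl this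
    simp [g, this]
  refine not_exists_contDiff_retraction hR (r := fun x => (R / ‖g x‖) • g x) ?_ ?_ ?_
  · refine ContDiff.smul (contDiff_const.div (hgs.norm ℝ hg0) fun x => ?_) hgs
    exact norm_ne_zero_iff.2 (hg0 x)
  · intro x
    have := norm_pos_iff.2 (hg0 x)
    rw [norm_smul, Real.norm_of_nonneg (by positivity), div_mul_cancel₀ _ this.ne']
  · intro x hx
    simp only [hgout x hx, hx, div_self hR.ne', one_smul]

/-- A cutoff `χ`, equal to `1` on a ball containing `K`, makes `x - χ x • F x` the identity far
away. At a zero, `x = χ x • F x` has norm at most that of a point of `K`, so `χ x = 1`. -/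
theorem exists_fixedPoint_of_continuous_forall_mem {K : Set E} (hK : IsCompact K)
    {F : E → E} (hF : Continuous F) (hmaps : ∀ x, F x ∈ K) :
    ∃ x ∈ K, F x = x := by
  obtain ⟨R, hR, hKR⟩ := hK.isBounded.exists_pos_norm_le
  let χ : E → ℝ := fun x => max 0 (min 1 (R + 1 - ‖x‖))
  have hχ : Continuous χ := by fun_prop
  have hχ0 : ∀ x, 0 ≤ χ x := fun x => le_max_left _ _
  have hχ1 : ∀ x, χ x ≤ 1 := fun x => max_le zero_le_one (min_le_left _ _)
  obtain ⟨x, hx⟩ := exists_zero_of_eq_id_outside (v := fun x => x - χ x • F x)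
    (R := R + 1) (by positivity) (by fun_prop) (fun x hx => by
      have : χ x = 0 := max_eq_left ((min_le_right _ _).trans (by linarith))
      simp [this])
  have hx : x = χ x • F x := sub_eq_zero.1 hx
  have hxR : ‖x‖ ≤ R := by
    rw [hx, norm_smul, Real.norm_of_nonneg (hχ0 x)]
    exact (mul_le_of_le_one_left (norm_nonneg _) (hχ1 x)).trans (hKR _ (hmaps x))
  have h1 : χ x = 1 := by
    simp only [χ]
    rw [min_eq_left (by linarith), max_eq_right zero_le_one]
  rw [h1, one_smul] at hx
  exact ⟨x, hx ▸ hmaps x, hx.symm⟩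

end Brouwer

/-! ### Brouwer for compact convex sets, and Ky Fan's inequality. -/

section KyFan

variable {V : Type*} [AddCommGroup V] [TopologicalSpace V] [IsTopologicalAddGroup V] [T2Space V]
  [Module ℝ V] [ContinuousSMul ℝ V] [FiniteDimensional ℝ V]

/-- Brouwer's fixed point theorem for compact convex sets in finite-dimensional spaces. -/
theorem IsCompact.exists_fixedPoint_of_convex {K : Set V} (hne : K.Nonempty) (hK : IsCompact K)
    (hc : Convex ℝ K) {F : K → V} (hF : Continuous F) (hmaps : ∀ x, F x ∈ K) :
    ∃ x : K, F x = x := by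
  let e := toEuclidean (E := V)
  have hK' : IsCompact (e '' K) := hK.image e.continuous
  have hc' : Convex ℝ (e '' K) := hc.linear_image e.toLinearMap
  obtain ⟨π, hπL, hπK, hπi⟩ := exists_lipschitz_projection (hne.image e) hK'.isClosed hc'
  have hmem : ∀ y, e.symm (π y) ∈ K := fun y => by
    obtain ⟨x, hx, hxy⟩ := hπK y
    rw [← hxy, e.symm_apply_apply]; exact hx
  obtain ⟨y, hy, hfix⟩ := exists_fixedPoint_of_continuous_forall_mem hK'
    (F := fun y => e (F ⟨e.symm (π y), hmem y⟩))
    (e.continuous.comp (hF.comp ((e.symm.continuous.comp hπL.continuous).subtype_mk _)))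
    (fun y => mem_image_of_mem e (hmaps _))
  have hself : π y = y := by
    have := hπi y y hy
    rw [real_inner_self_eq_norm_sq] at this
    have : ‖y - π y‖ = 0 := by nlinarith [norm_nonneg (y - π y)]
    exact (sub_eq_zero.1 (norm_eq_zero.1 this)).symm
  refine ⟨⟨e.symm (π y), hmem y⟩, e.injective ?_⟩
  rw [hfix, e.apply_symm_apply, hself]

/-- Ky Fan's inequality. -/
theorem IsCompact.exists_forall_le_zero_of_concaveOn {K : Set V} (hne : K.Nonempty)
    (hK : IsCompact K) (hc : Convex ℝ K) {φ : V → V → ℝ}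
    (hcont : ∀ q ∈ K, ContinuousOn (fun x => φ x q) K)
    (hconc : ∀ x ∈ K, ConcaveOn ℝ K (φ x)) (hdiag : ∀ x ∈ K, φ x x ≤ 0) :
    ∃ x ∈ K, ∀ q ∈ K, φ x q ≤ 0 := by
  by_contra! hcon
  have : CompactSpace K := isCompact_iff_compactSpace.1 hK
  -- If the claim fails, the sets of `q` with `0 < φ x q` are nonempty and convex, and each `q`
  -- remains admissible for nearby `x`. A continuous selection exists, and its fixed point violates
  -- the diagonal condition.
  obtain ⟨g, hg⟩ := exists_continuous_forall_mem_convex_of_local_const (X := K)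
    (t := fun x => {q ∈ K | 0 < φ x q}) (fun x => (hconc x x.2).convex_gt 0) (fun x => by
      obtain ⟨q, hq, hpos⟩ := hcon x x.2
      refine ⟨q, ?_⟩
      filter_upwards [(hcont q hq).domRestrict.continuousAt.eventually (lt_mem_nhds hpos)]
        with y hy using ⟨hq, hy⟩)
  obtain ⟨x, hx⟩ := hK.exists_fixedPoint_of_convex hne hc g.continuous fun x => (hg x).1
  have := (hg x).2
  rw [hx] at this
  exact (hdiag x x.2).not_gt this

end KyFan

/-! ### Laws of the chain and payoffs as time integrals. -/

/-- A right-continuous process on `[0, ∞)` with values in a finite type is jointly measurable. -/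
theorem measurable_uncurry_of_rightContinuous {N : ℕ} {Ω : Type*} [MeasurableSpace Ω]
    {Y : ℝ → Ω → Fin N} (hm : ∀ t, Measurable (Y t))
    (hr : ∀ ω t, ContinuousWithinAt (fun u => Y u ω) (Ici t) t) :
    Measurable fun p : ℝ × Ω => Y p.1 p.2 := by
  refine measurable_of_tendsto_metrizable
    -- The `+ 1` after the floor puts the grid times to the right of `t`, where continuity is
    -- available.
    (f := fun (n : ℕ) (p : ℝ × Ω) => Y ((⌊((n : ℝ) + 1) * p.1⌋ + 1) / (n + 1)) p.2)
    (fun n => ?_) (tendsto_pi_nhds.2 fun p => ?_)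
  · have h : Measurable fun q : ℤ × Ω => Y (((q.1 : ℝ) + 1) / (n + 1)) q.2 :=
      measurable_from_prod_countable_right fun k => hm (((k : ℝ) + 1) / (n + 1))
    exact h.comp (((measurable_fst.const_mul _).floor).prodMk measurable_snd)
  · have hlow : ∀ n : ℕ, p.1 ≤ (⌊((n : ℝ) + 1) * p.1⌋ + 1) / (n + 1) := fun n => by
      rw [le_div_iff₀ (by positivity), mul_comm]
      exact (Int.lt_floor_add_one _).le
    have hupp : ∀ n : ℕ, ((⌊((n : ℝ) + 1) * p.1⌋ : ℝ) + 1) / (n + 1) ≤ p.1 + 1 / ((n : ℝ) + 1) :=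
      fun n => by
        have := Int.floor_le (((n : ℝ) + 1) * p.1)
        have h1 : (1 / ((n : ℝ) + 1)) * (n + 1) = 1 := by field_simp
        rw [div_le_iff₀ (by positivity), add_mul _ _ ((n : ℝ) + 1), h1]
        linarith
    have hlim : Tendsto (fun n : ℕ => ((⌊((n : ℝ) + 1) * p.1⌋ : ℝ) + 1) / (n + 1)) atTop
        (𝓝 p.1) := by
      refine tendsto_of_tendsto_of_tendsto_of_le_of_le tendsto_const_nhds ?_ hlow hupp
      simpa using (tendsto_const_nhds (x := p.1)).add (tendsto_one_div_add_atTop_nhds_zero_nat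
        (𝕜 := ℝ))
    exact (hr p.2 p.1).tendsto.comp
      (tendsto_nhdsWithin_iff.2 ⟨hlim, Eventually.of_forall hlow⟩)

namespace EquilibriumControl

variable {N : ℕ} {Ω : Type*} [MeasurableSpace Ω] {X : ℝ → Ω → Fin N} {P : Measure Ω} {i : Fin N}
  {A : ℝ → Matrix (Fin N) (Fin N) ℝ} {Q R : Matrix (Fin N) (Fin N) ℝ} {ε : ℝ}

theorem concat_self (Q : Matrix (Fin N) (Fin N) ℝ) (ε : ℝ) : concat Q ε Q = fun _ => Q := by
  funext t
  simp [concat]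

theorem IsMarkovChain.prob_of_le (h : IsMarkovChain X P i A) {t : ℝ} (ht : 0 ≤ t)
    (hA : ∀ u ∈ Ioc 0 t, A u = Q) (j : Fin N) :
    P.real {ω | X t ω = j} = NormedSpace.exp (t • Q) i j := by
  have := h.isProbabilityMeasure
  have hm := h.markov 0 t Q le_rfl ht hA univ MeasurableSet.univ i j
  have h0 : P.real {ω | X 0 ω = i} = 1 := by
    rw [measureReal_congr (eventuallyEq_univ.2 h.initial), probReal_univ]
  have h1 : P.real {ω | X 0 ω = i ∧ X t ω = j} = P.real {ω | X t ω = j} := by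
    refine measureReal_congr ?_
    filter_upwards [h.initial] with ω hω
    exact propext ⟨fun h => h.2, fun h => ⟨hω, h⟩⟩
  rw [univ_inter, univ_inter, h0, h1, one_mul, sub_zero] at hm
  exact hm

/-- Condition on the state at the switching time `ε` and apply the Markov property on each side. -/
theorem IsMarkovChain.prob_of_gt (h : IsMarkovChain X P i (concat Q ε R)) (hε : 0 < ε) {t : ℝ}
    (ht : ε ≤ t) (j : Fin N) :
    P.real {ω | X t ω = j} =
      (NormedSpace.exp (ε • Q) * NormedSpace.exp ((t - ε) • R) : Matrix _ _ ℝ) i j := by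
  have := h.isProbabilityMeasure
  rw [Matrix.mul_apply]
  have hsplit : P.real {ω | X t ω = j} = ∑ k, P.real {ω | X ε ω = k ∧ X t ω = j} := by
    rw [← measureReal_iUnion_fintype]
    · congr 1
      ext ω
      simp
    · intro k l hkl
      refine disjoint_left.2 fun ω hk hl => hkl (hk.1.symm.trans hl.1)
    · intro k
      exact ((h.measurable ε hε.le) (measurableSet_singleton k)).inter
        ((h.measurable t (hε.le.trans ht)) (measurableSet_singleton j))
  rw [hsplit]
  refine Finset.sum_congr rfl fun k _ => ?_
  have hm := h.markov ε t R hε.le ht (fun u hu => by simp [concat, hu.1]) univ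
    MeasurableSet.univ k j
  rw [univ_inter, univ_inter] at hm
  rw [hm, h.prob_of_le hε.le (Q := Q) (fun u hu => by simp [concat, hu.2]) k]

/-- The expected integral of a running payoff is the integral of its expectation. -/
theorem IsMarkovChain.integral_integral_eq (h : IsMarkovChain X P i A) {a : ℝ → Fin N → ℝ}
    (ha : ∀ j, IntegrableOn (fun t => a t j) (Ioi 0)) :
    IntegrableOn (fun t => ∑ j, P.real {ω | X t ω = j} * a t j) (Ioi 0) ∧
      ∫ ω, (∫ t in Ioi (0 : ℝ), a t (X t ω)) ∂P =
        ∫ t in Ioi (0 : ℝ), ∑ j, P.real {ω | X t ω = j} * a t j := by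
  have := h.isProbabilityMeasure
  -- Freezing the process at negative times makes it measurable and right-continuous on all of `ℝ`.
  let Y : ℝ → Ω → Fin N := fun t => X (max t 0)
  have hYX : ∀ t ∈ Ioi (0 : ℝ), Y t = X t := fun t ht => by
    simp only [Y, max_eq_left (le_of_lt (mem_Ioi.1 ht))]
  have hY : Measurable fun p : ℝ × Ω => Y p.1 p.2 := by
    refine measurable_uncurry_of_rightContinuous (fun t => h.measurable _ (le_max_right _ _))
      fun ω t => ?_
    refine ContinuousWithinAt.comp (t := Ici (max t 0)) (f := fun u => max u 0)
      (g := fun u => X u ω) (h.right_continuous ω _ (le_max_right _ _))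
      (by fun_prop) fun u hu => ?_
    exact max_le_max (mem_Ici.1 hu) le_rfl
  have hind : ∀ j, MeasurableSet {p : Ω × ℝ | Y p.2 p.1 = j} := fun j =>
    (hY.comp measurable_swap) (measurableSet_singleton j)
  let g : Fin N → Ω → ℝ → ℝ := fun j ω t => {p : Ω × ℝ | Y p.2 p.1 = j}.indicator
    (fun p => a p.2 j) (ω, t)
  have hg : ∀ j, Integrable (Function.uncurry (g j)) (P.prod (volume.restrict (Ioi 0))) :=
    fun j => Integrable.indicator ((ha j).comp_snd P) (hind j)
  have hsum : ∀ ω, ∀ t ∈ Ioi (0 : ℝ), a t (X t ω) = ∑ j, g j ω t := fun ω t ht => by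
    simp [g, indicator_apply, hYX t ht]
  have hinner : ∀ j, ∀ t ∈ Ioi (0 : ℝ), ∫ ω, g j ω t ∂P = P.real {ω | X t ω = j} * a t j := by
    intro j t ht
    have : (fun ω => g j ω t) = {ω | X t ω = j}.indicator fun _ => a t j := by
      funext ω
      simp [g, indicator_apply, hYX t ht]
    rw [this]
    exact integral_indicator_const _ ((h.measurable t (le_of_lt ht)) (measurableSet_singleton j))
  have hgsum : Integrable (Function.uncurry fun ω t => ∑ j, g j ω t)
      (P.prod (volume.restrict (Ioi 0))) := integrable_finsetSum _ fun j _ => hg j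
  have hae : (fun t => ∫ ω, ∑ j, g j ω t ∂P) =ᵐ[volume.restrict (Ioi (0 : ℝ))]
      fun t => ∑ j, P.real {ω | X t ω = j} * a t j := by
    have hae : ∀ j, ∀ᵐ t ∂(volume.restrict (Ioi (0 : ℝ))), Integrable (fun ω => g j ω t) P :=
      fun j => (hg j).prod_left_ae
    filter_upwards [ae_all_iff.2 hae, ae_restrict_mem measurableSet_Ioi] with t h1 h2
    rw [integral_finsetSum _ fun j _ => h1 j]
    exact Finset.sum_congr rfl fun j _ => hinner j t h2
  refine ⟨hgsum.integral_prod_right.congr hae, ?_⟩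
  calc ∫ ω, (∫ t in Ioi (0 : ℝ), a t (X t ω)) ∂P
      = ∫ ω, (∫ t in Ioi (0 : ℝ), ∑ j, g j ω t) ∂P := by
        congr 1 with ω
        exact setIntegral_congr_fun measurableSet_Ioi (hsum ω)
    _ = ∫ t in Ioi (0 : ℝ), ∫ ω, ∑ j, g j ω t ∂P := integral_integral_swap hgsum
    _ = _ := integral_congr_ae hae

variable {D : Fin N → Set (Fin N → ℝ)} {f : ℝ → Fin N → (Fin N → ℝ) → ℝ}
  {Pc : Fin N → (ℝ → Matrix (Fin N) (Fin N) ℝ) → Measure Ω}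

theorem IntegrabilityCondition.integrableOn (hf : IntegrabilityCondition D f) {j : Fin N}
    {q : Fin N → ℝ} (hq : q ∈ D j) (hc : ContinuousOn (fun t => f t j q) (Ici 0)) :
    IntegrableOn (fun t => f t j q) (Ioi 0) := by
  refine ⟨(hc.mono Ioi_subset_Ici_self).aestronglyMeasurable measurableSet_Ioi, ?_⟩
  refine lt_of_le_of_lt (lintegral_mono fun t => ?_) (hf (‖WithLp.toLp 2 q‖ + 1) (by positivity))
  rw [← ofReal_norm, Real.norm_eq_abs]
  exact le_iSup₂_of_le j q (le_iSup₂_of_le hq (by linarith) le_rfl)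

/-- The entries are transition probabilities of the given chain. -/
theorem exp_smul_apply_nonneg_le_one (hX : IsControlledChain D X Pc) (hQ : Q ∈ controlSpace D)
    {t : ℝ} (ht : 0 ≤ t) (i j : Fin N) :
    0 ≤ NormedSpace.exp (t • Q) i j ∧ NormedSpace.exp (t • Q) i j ≤ 1 := by
  have h := hX i Q hQ Q hQ 1 one_pos
  have := h.isProbabilityMeasure
  rw [← h.prob_of_le ht (Q := Q) (fun u _ => by simp [concat]) j]
  exact ⟨measureReal_nonneg, measureReal_le_one⟩

theorem payoff_const_eq (hX : IsControlledChain D X Pc)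
    (hf : ∀ j, ∀ q ∈ D j, IntegrableOn (fun t => f t j q) (Ioi 0)) (hQ : Q ∈ controlSpace D)
    (i : Fin N) :
    payoff f X Pc i (fun _ => Q) =
      ∫ t in Ioi (0 : ℝ), ∑ j, NormedSpace.exp (t • Q) i j * f t j (Q j) := by
  have h := hX i Q hQ Q hQ 1 one_pos
  rw [concat_self] at h
  refine (h.integral_integral_eq (a := fun t j => f t j (Q j)) fun j => hf j _ (hQ j)).2.trans
    (setIntegral_congr_fun measurableSet_Ioi fun t ht => ?_)
  refine Finset.sum_congr rfl fun j _ => ?_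
  rw [h.prob_of_le (le_of_lt ht) (fun _ _ => rfl)]

theorem payoff_concat_eq (hX : IsControlledChain D X Pc)
    (hf : ∀ j, ∀ q ∈ D j, IntegrableOn (fun t => f t j q) (Ioi 0)) (hQ : Q ∈ controlSpace D)
    (hR : R ∈ controlSpace D) (hε : 0 < ε) (i : Fin N) :
    payoff f X Pc i (concat Q ε R) =
      (∫ t in Ioc 0 ε, ∑ j, NormedSpace.exp (t • Q) i j * f t j (Q j)) +
      ∫ t in Ioi ε, ∑ j, (NormedSpace.exp (ε • Q) * NormedSpace.exp ((t - ε) • R) :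
        Matrix _ _ ℝ) i j * f t j (R j) := by
  have h := hX i Q hQ R hR ε hε
  have := h.isProbabilityMeasure
  have hsub : Ioi ε ⊆ Ioi (0 : ℝ) := Ioi_subset_Ioi hε.le
  have hset : Ioc 0 ε ∪ Ioi ε = Ioi (0 : ℝ) := Ioc_union_Ioi_eq_Ioi hε.le
  have ha : ∀ j, IntegrableOn (fun t => f t j (concat Q ε R t j)) (Ioi 0) := fun j => by
    rw [← hset]
    refine IntegrableOn.union ?_ ?_
    · refine ((hf j _ (hQ j)).mono_set Ioc_subset_Ioi_self).congr_fun (fun t ht => ?_)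
        measurableSet_Ioc
      simp [concat, ht.2]
    · refine ((hf j _ (hR j)).mono_set hsub).congr_fun (fun t ht => ?_) measurableSet_Ioi
      simp [concat, not_le.2 (mem_Ioi.1 ht)]
  obtain ⟨hint, heq⟩ := h.integral_integral_eq (a := fun t j => f t j (concat Q ε R t j)) ha
  refine heq.trans ?_
  rw [← hset] at hint ⊢
  rw [setIntegral_union (Ioc_disjoint_Ioi le_rfl) measurableSet_Ioi
    (hint.mono_set subset_union_left) (hint.mono_set subset_union_right)]
  congr 1
  · refine setIntegral_congr_fun measurableSet_Ioc fun t ht => Finset.sum_congr rfl fun j _ => ?_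
    rw [h.prob_of_le ht.1.le (Q := Q) fun u hu => by simp [concat, hu.2.trans ht.2]]
    simp [concat, ht.2]
  · refine setIntegral_congr_fun measurableSet_Ioi fun t ht => Finset.sum_congr rfl fun j _ => ?_
    rw [h.prob_of_gt hε (le_of_lt ht)]
    simp [concat, not_le.2 (mem_Ioi.1 ht)]

end EquilibriumControl

/-! ### Matrix exponentials and the backward equation. -/

section MatrixExponential

open scoped Matrix

variable {ι : Type*} [Fintype ι]

theorem HasDerivAt.mulVec {M : ℝ → Matrix ι ι ℝ} {M' : Matrix ι ι ℝ} {v : ℝ → ι → ℝ} {v' : ι → ℝ}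
    {t : ℝ} (hM : ∀ i j, HasDerivAt (fun t => M t i j) (M' i j) t) (hv : HasDerivAt v v' t) :
    HasDerivAt (fun t => M t *ᵥ v t) (M' *ᵥ v t + M t *ᵥ v') t := by
  refine hasDerivAt_pi.2 fun i => ?_
  have := HasDerivAt.fun_sum (u := Finset.univ) fun j _ => (hM i j).mul (hasDerivAt_pi.1 hv j)
  rw [Finset.sum_add_distrib] at this
  exact this

theorem Matrix.integral_mulVec {α : Type*} [MeasurableSpace α] {μ : Measure α} (M : Matrix ι ι ℝ)
    {w : α → ι → ℝ} (hw : Integrable w μ) : ∫ x, M *ᵥ w x ∂μ = M *ᵥ ∫ x, w x ∂μ :=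
  (Matrix.mulVecLin M).toContinuousLinearMap.integral_comp_comm hw

variable [DecidableEq ι]

theorem hasDerivAt_exp_smul_apply (Q : Matrix ι ι ℝ) (t : ℝ) (i j : ι) :
    HasDerivAt (fun t : ℝ => NormedSpace.exp (t • Q) i j) ((NormedSpace.exp (t • Q) * Q) i j) t := by
  open scoped Matrix.Norms.Operator in
  exact hasDerivAt_pi.1 (hasDerivAt_pi.1 (hasDerivAt_exp_smul_const Q t) i) j

theorem Matrix.continuous_exp :
    Continuous (NormedSpace.exp : Matrix ι ι ℝ → Matrix ι ι ℝ) := by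
  open scoped Matrix.Norms.Operator in
  exact NormedSpace.exp_continuous

theorem Matrix.exp_add_smul (Q : Matrix ι ι ℝ) (s t : ℝ) :
    NormedSpace.exp ((s + t) • Q) = NormedSpace.exp (s • Q) * NormedSpace.exp (t • Q) := by
  rw [add_smul]
  exact Matrix.exp_add_of_commute _ _ ((Commute.refl Q).smul_left s |>.smul_right t)

theorem Matrix.continuous_exp_smul (Q : Matrix ι ι ℝ) :
    Continuous fun t : ℝ => NormedSpace.exp (t • Q) :=
  Matrix.continuous_exp.comp (by fun_prop)

theorem Matrix.exp_neg_smul_mul_exp_smul (Q : Matrix ι ι ℝ) (t : ℝ) :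
    NormedSpace.exp ((-t) • Q) * NormedSpace.exp (t • Q) = 1 := by
  rw [← Matrix.exp_add_smul]
  simp

/-- The solution of the backward equation `y' = -R y - φ`, `y 0 = v`. -/
noncomputable def backwardSolution (R : Matrix ι ι ℝ) (φ : ℝ → ι → ℝ) (v : ι → ℝ) (t : ℝ) : ι → ℝ :=
  NormedSpace.exp ((-t) • R) *ᵥ (v - ∫ u in (0 : ℝ)..t, NormedSpace.exp (u • R) *ᵥ φ u)

variable {Q R : Matrix ι ι ℝ} {φ : ℝ → ι → ℝ} {v : ι → ℝ}

theorem backwardSolution_zero : backwardSolution R φ v 0 = v := by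
  simp [backwardSolution]

theorem hasDerivAt_backwardSolution (hφ : Continuous φ) (t : ℝ) :
    HasDerivAt (backwardSolution R φ v) (-(R *ᵥ backwardSolution R φ v t) - φ t) t := by
  have hc : Continuous fun u : ℝ => NormedSpace.exp (u • R) *ᵥ φ u :=
    (Matrix.continuous_exp_smul R).matrix_mulVec hφ
  have h1 := (hc.integral_hasStrictDerivAt 0 t).hasDerivAt.const_sub v
  have h2 : ∀ i j, HasDerivAt (fun t : ℝ => NormedSpace.exp ((-t) • R) i j)
      ((-(R * NormedSpace.exp ((-t) • R))) i j) t := fun i j => by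
    have h := (hasDerivAt_exp_smul_apply R (-t) i j).scomp t (hasDerivAt_neg t)
    have hcomm : NormedSpace.exp ((-t) • R) * R = R * NormedSpace.exp ((-t) • R) :=
      (((Commute.refl R).smul_left (-t)).exp_left).eq
    rw [hcomm, neg_one_smul] at h
    exact h
  have h := HasDerivAt.mulVec h2 h1
  convert! h using 1
  rw [Matrix.neg_mulVec, Matrix.mulVec_neg, Matrix.mulVec_mulVec, Matrix.exp_neg_smul_mul_exp_smul,
    Matrix.one_mulVec, ← Matrix.mulVec_mulVec, sub_eq_add_neg]
  rfl

theorem continuous_backwardSolution (hφ : Continuous φ) : Continuous (backwardSolution R φ v) :=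
  continuous_iff_continuousAt.2 fun t => (hasDerivAt_backwardSolution hφ t).continuousAt

/-- Variation of constants between the generators `Q` and `R`. -/
theorem exp_smul_mulVec_backwardSolution_sub (hφ : Continuous φ) (ε : ℝ) :
    NormedSpace.exp (ε • Q) *ᵥ backwardSolution R φ v ε - v =
      ∫ t in (0 : ℝ)..ε, NormedSpace.exp (t • Q) *ᵥ
        ((Q - R) *ᵥ backwardSolution R φ v t - φ t) := by
  have hy := continuous_backwardSolution (R := R) (v := v) hφ
  have hder : ∀ t : ℝ, HasDerivAt
      (fun t : ℝ => NormedSpace.exp (t • Q) *ᵥ backwardSolution R φ v t)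
      (NormedSpace.exp (t • Q) *ᵥ ((Q - R) *ᵥ backwardSolution R φ v t - φ t)) t := fun t => by
    -- In the product rule, `exp (t Q) Q y` from the exponential meets `-exp (t Q) (R y + φ)` from
    -- the backward equation, leaving only `Q - R` and the source term.
    have h := HasDerivAt.mulVec (hasDerivAt_exp_smul_apply Q t)
      (hasDerivAt_backwardSolution (R := R) (v := v) hφ t)
    convert h using 1
    rw [← Matrix.mulVec_mulVec, ← Matrix.mulVec_add, Matrix.sub_mulVec]
    congr 1
    abel
  have hcont : Continuous fun t : ℝ => NormedSpace.exp (t • Q) *ᵥ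
      ((Q - R) *ᵥ backwardSolution R φ v t - φ t) :=
    (Matrix.continuous_exp_smul Q).matrix_mulVec
      ((continuous_const.matrix_mulVec hy).sub hφ)
  have := intervalIntegral.integral_eq_sub_of_hasDerivAt (fun t _ => hder t)
    (hcont.intervalIntegrable 0 ε)
  rw [this]
  simp [backwardSolution_zero]

end MatrixExponential

/-! ### The exact loss caused by a deviation. -/

namespace EquilibriumControl

open scoped Matrix

variable {N : ℕ} {Ω : Type*} [MeasurableSpace Ω] {X : ℝ → Ω → Fin N}
  {Q R : Matrix (Fin N) (Fin N) ℝ} {ε : ℝ}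
  {D : Fin N → Set (Fin N → ℝ)} {f : ℝ → Fin N → (Fin N → ℝ) → ℝ}
  {Pc : Fin N → (ℝ → Matrix (Fin N) (Fin N) ℝ) → Measure Ω}

/-- The running payoffs of the states under the control `Q`, extended constantly to negative
times. -/
def runningPayoff (f : ℝ → Fin N → (Fin N → ℝ) → ℝ) (Q : Matrix (Fin N) (Fin N) ℝ) (t : ℝ) :
    Fin N → ℝ :=
  fun j => f (max t 0) j (Q j)

theorem runningPayoff_of_nonneg {t : ℝ} (ht : 0 ≤ t) (j : Fin N) :
    runningPayoff f Q t j = f t j (Q j) := by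
  rw [runningPayoff, max_eq_left ht]

theorem continuous_runningPayoff
    (hf_time : ∀ i, ∀ q ∈ D i, ContinuousOn (fun t => f t i q) (Ici 0))
    (hQ : Q ∈ controlSpace D) : Continuous (runningPayoff f Q) :=
  continuous_pi fun j => (hf_time j _ (hQ j)).comp_continuous (f := fun t => max t 0) (by fun_prop)
    fun t => le_max_right t 0

theorem integrableOn_exp_smul_mulVec (hX : IsControlledChain D X Pc)
    (hf : ∀ j, ∀ q ∈ D j, IntegrableOn (fun t => f t j q) (Ioi 0)) (hQ : Q ∈ controlSpace D) :
    IntegrableOn (fun t : ℝ => NormedSpace.exp (t • Q) *ᵥ runningPayoff f Q t) (Ioi 0) := by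
  refine Integrable.of_eval fun i => ?_
  suffices h : ∀ j, IntegrableOn (fun t : ℝ => NormedSpace.exp (t • Q) i j * runningPayoff f Q t j)
      (Ioi 0) by
    have := integrable_finsetSum Finset.univ fun j _ => h j
    exact this
  intro j
  have h1 : IntegrableOn (fun t => runningPayoff f Q t j) (Ioi 0) :=
    (hf j _ (hQ j)).congr_fun (fun t ht => (runningPayoff_of_nonneg (le_of_lt ht) j).symm)
      measurableSet_Ioi
  refine h1.bdd_mul (c := 1) ?_ ?_
  · exact ((Matrix.continuous_exp_smul Q).matrix_elem i j).aestronglyMeasurable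
  · filter_upwards [ae_restrict_mem measurableSet_Ioi] with t ht
    obtain ⟨h0, h1⟩ := exp_smul_apply_nonneg_le_one hX hQ (le_of_lt ht) i j
    rwa [Real.norm_of_nonneg h0]

theorem payoff_const_eq_integral (hX : IsControlledChain D X Pc)
    (hf : ∀ j, ∀ q ∈ D j, IntegrableOn (fun t => f t j q) (Ioi 0)) (hQ : Q ∈ controlSpace D) :
    (fun i => payoff f X Pc i (fun _ => Q)) =
      ∫ t in Ioi (0 : ℝ), NormedSpace.exp (t • Q) *ᵥ runningPayoff f Q t := by
  funext i
  rw [eval_integral fun i => (integrableOn_exp_smul_mulVec hX hf hQ).eval i,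
    payoff_const_eq hX hf hQ]
  refine setIntegral_congr_fun measurableSet_Ioi fun t ht => ?_
  exact Finset.sum_congr rfl fun j _ => by rw [runningPayoff_of_nonneg (le_of_lt ht)]

/-- The advantage of the control `R` over the control `Q` at time `t`, when `R` is used
afterwards. -/
noncomputable def advantage (f : ℝ → Fin N → (Fin N → ℝ) → ℝ) (R Q : Matrix (Fin N) (Fin N) ℝ)
    (v : Fin N → ℝ) (t : ℝ) : Fin N → ℝ :=
  runningPayoff f R t - runningPayoff f Q t +
    (R - Q) *ᵥ backwardSolution R (runningPayoff f R) v t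

theorem continuous_advantage (hf_time : ∀ i, ∀ q ∈ D i, ContinuousOn (fun t => f t i q) (Ici 0))
    (hQ : Q ∈ controlSpace D) (hR : R ∈ controlSpace D) (v : Fin N → ℝ) :
    Continuous (advantage f R Q v) :=
  ((continuous_runningPayoff hf_time hR).sub (continuous_runningPayoff hf_time hQ)).add
    (continuous_const.matrix_mulVec
      (continuous_backwardSolution (continuous_runningPayoff hf_time hR)))

/-- With initial value the payoff vector of `R`, the backward solution at `ε` is the vector of
payoffs still to be collected after `ε` under `R`: subtracting the part up to `ε` leaves the tail
integral, and `exp (-ε R)` restarts it at time `ε`. -/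
theorem payoff_concat_eq_apply (hX : IsControlledChain D X Pc)
    (hf : ∀ j, ∀ q ∈ D j, IntegrableOn (fun t => f t j q) (Ioi 0)) (hQ : Q ∈ controlSpace D)
    (hR : R ∈ controlSpace D) (hε : 0 < ε) (i : Fin N) :
    payoff f X Pc i (concat Q ε R) =
      ((∫ t in (0 : ℝ)..ε, NormedSpace.exp (t • Q) *ᵥ runningPayoff f Q t) +
      NormedSpace.exp (ε • Q) *ᵥ backwardSolution R (runningPayoff f R)
        (fun k => payoff f X Pc k (fun _ => R)) ε) i := by
  have hwQ := integrableOn_exp_smul_mulVec hX hf hQ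
  have hwR := integrableOn_exp_smul_mulVec hX hf hR
  have hsub : Ioi ε ⊆ Ioi (0 : ℝ) := Ioi_subset_Ioi hε.le
  have htail : (fun k => payoff f X Pc k (fun _ => R)) -
      ∫ u in (0 : ℝ)..ε, NormedSpace.exp (u • R) *ᵥ runningPayoff f R u =
      ∫ u in Ioi ε, NormedSpace.exp (u • R) *ᵥ runningPayoff f R u := by
    rw [payoff_const_eq_integral hX hf hR, intervalIntegral.integral_of_le hε.le,
      ← Ioc_union_Ioi_eq_Ioi hε.le, setIntegral_union (Ioc_disjoint_Ioi le_rfl) measurableSet_Ioi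
      (hwR.mono_set Ioc_subset_Ioi_self) (hwR.mono_set hsub), add_sub_cancel_left]
  rw [payoff_concat_eq hX hf hQ hR hε, Pi.add_apply, backwardSolution, htail,
    Matrix.mulVec_mulVec, ← Matrix.integral_mulVec _ (hwR.mono_set hsub),
    intervalIntegral.integral_of_le hε.le]
  congr 1
  · rw [eval_integral fun i => (hwQ.mono_set Ioc_subset_Ioi_self).eval i]
    refine setIntegral_congr_fun measurableSet_Ioc fun t ht => ?_
    exact Finset.sum_congr rfl fun j _ => by rw [runningPayoff_of_nonneg ht.1.le]
  · have hint : IntegrableOn (fun t : ℝ =>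
        (NormedSpace.exp (ε • Q) * NormedSpace.exp ((-ε) • R)) *ᵥ
          (NormedSpace.exp (t • R) *ᵥ runningPayoff f R t)) (Ioi ε) :=
      (Matrix.mulVecLin (NormedSpace.exp (ε • Q) *
        NormedSpace.exp ((-ε) • R))).toContinuousLinearMap.integrable_comp (hwR.mono_set hsub)
    rw [eval_integral fun i => hint.eval i]
    refine setIntegral_congr_fun measurableSet_Ioi fun t ht => ?_
    rw [Matrix.mulVec_mulVec, mul_assoc, ← Matrix.exp_add_smul, neg_add_eq_sub]
    exact Finset.sum_congr rfl fun j _ => by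
      rw [runningPayoff_of_nonneg (hε.le.trans (le_of_lt ht))]

theorem continuous_exp_smul_mulVec_advantage
    (hf_time : ∀ i, ∀ q ∈ D i, ContinuousOn (fun t => f t i q) (Ici 0))
    (hQ : Q ∈ controlSpace D) (hR : R ∈ controlSpace D) (v : Fin N → ℝ) (i : Fin N) :
    Continuous fun t : ℝ => (NormedSpace.exp (t • Q) *ᵥ advantage f R Q v t) i :=
  continuous_pi_iff.1
    ((Matrix.continuous_exp_smul Q).matrix_mulVec (continuous_advantage hf_time hQ hR v)) i

/-- The loss caused by a deviation to `Q` on `[0, ε]` is the expected integral of the advantage of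
`R` over `Q` along the deviating chain. -/
theorem payoff_sub_payoff_concat (hX : IsControlledChain D X Pc)
    (hf_time : ∀ i, ∀ q ∈ D i, ContinuousOn (fun t => f t i q) (Ici 0))
    (hf : ∀ j, ∀ q ∈ D j, IntegrableOn (fun t => f t j q) (Ioi 0)) (hQ : Q ∈ controlSpace D)
    (hR : R ∈ controlSpace D) (hε : 0 < ε) (i : Fin N) :
    payoff f X Pc i (fun _ => R) - payoff f X Pc i (concat Q ε R) =
      ∫ t in (0 : ℝ)..ε, (NormedSpace.exp (t • Q) *ᵥ
        advantage f R Q (fun k => payoff f X Pc k (fun _ => R)) t) i := by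
  set v : Fin N → ℝ := fun k => payoff f X Pc k (fun _ => R) with hv
  have hφ := continuous_runningPayoff hf_time hR
  have hψ := continuous_runningPayoff hf_time hQ
  have hy := continuous_backwardSolution (R := R) (v := v) hφ
  have hc1 : Continuous fun t : ℝ => NormedSpace.exp (t • Q) *ᵥ
      ((Q - R) *ᵥ backwardSolution R (runningPayoff f R) v t - runningPayoff f R t) :=
    (Matrix.continuous_exp_smul Q).matrix_mulVec ((continuous_const.matrix_mulVec hy).sub hφ)
  have hc2 : Continuous fun t : ℝ => NormedSpace.exp (t • Q) *ᵥ runningPayoff f Q t :=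
    (Matrix.continuous_exp_smul Q).matrix_mulVec hψ
  have hvar := exp_smul_mulVec_backwardSolution_sub (Q := Q) (R := R) (v := v) hφ ε
  have hkey : v - ((∫ t in (0 : ℝ)..ε, NormedSpace.exp (t • Q) *ᵥ runningPayoff f Q t) +
      NormedSpace.exp (ε • Q) *ᵥ backwardSolution R (runningPayoff f R) v ε) =
      ∫ t in (0 : ℝ)..ε, NormedSpace.exp (t • Q) *ᵥ advantage f R Q v t := by
    rw [sub_eq_iff_eq_add.1 hvar]
    have : ∀ t : ℝ, NormedSpace.exp (t • Q) *ᵥ advantage f R Q v t =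
        -(NormedSpace.exp (t • Q) *ᵥ runningPayoff f Q t) - NormedSpace.exp (t • Q) *ᵥ
        ((Q - R) *ᵥ backwardSolution R (runningPayoff f R) v t - runningPayoff f R t) := fun t => by
      rw [← Matrix.mulVec_neg, ← Matrix.mulVec_sub, advantage, ← neg_sub Q R, Matrix.neg_mulVec]
      congr 1
      abel
    simp_rw [this]
    rw [intervalIntegral.integral_sub (f := fun t : ℝ =>
      -(NormedSpace.exp (t • Q) *ᵥ runningPayoff f Q t)) (hc2.neg.intervalIntegrable _ _)
      (hc1.intervalIntegrable _ _), intervalIntegral.integral_neg]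
    abel
  have hc3 := (Matrix.continuous_exp_smul Q).matrix_mulVec (continuous_advantage hf_time hQ hR v)
  rw [payoff_concat_eq_apply hX hf hQ hR hε i]
  have := congrFun hkey i
  rw [intervalIntegral.integral_of_le hε.le (f := fun t : ℝ =>
    NormedSpace.exp (t • Q) *ᵥ advantage f R Q v t), eval_integral fun i =>
      (((continuous_pi_iff.1 hc3 i).intervalIntegrable 0 ε).1),
    ← intervalIntegral.integral_of_le hε.le] at this
  exact this

/-! ### Continuity of the payoff in the control. -/

/-- For compact `D j` the integrability condition gives an integrable bound. The supremum over a
countable dense subset is measurable. -/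
theorem IntegrabilityCondition.exists_integrable_bound (hf : IntegrabilityCondition D f)
    {j : Fin N} (hD : IsCompact (D j))
    (hf_time : ∀ q ∈ D j, ContinuousOn (fun t => f t j q) (Ici 0))
    (hf_row : ∀ t ≥ 0, ContinuousOn (f t j) (D j)) :
    ∃ b : ℝ → ℝ, IntegrableOn b (Ioi 0) ∧
      ∀ᵐ t ∂(volume.restrict (Ioi (0 : ℝ))), ∀ q ∈ D j, |f t j q| ≤ b t := by
  obtain ⟨C, hCD, hCc, hDC⟩ := hD.isSeparable.exists_countable_dense_subset
  obtain ⟨c, hc, hcD⟩ :=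
    (hD.image (PiLp.continuous_toLp 2 fun _ : Fin N => ℝ)).isBounded.exists_pos_norm_le
  let S : ℝ → ENNReal := fun t => ⨆ q ∈ C, ENNReal.ofReal |f t j q|
  have hSm : AEMeasurable S (volume.restrict (Ioi 0)) := by
    refine AEMeasurable.biSup C hCc fun q hq => ?_
    exact ((((hf_time q (hCD hq)).abs).mono Ioi_subset_Ici_self).aemeasurable
      measurableSet_Ioi).ennreal_ofReal
  have hSint : ∫⁻ t in Ioi (0 : ℝ), S t < ⊤ := by
    refine lt_of_le_of_lt (lintegral_mono fun t => iSup₂_le fun q hq => ?_) (hf c hc)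
    exact le_iSup₂_of_le j q
      (le_iSup₂_of_le (hCD hq) (hcD _ (mem_image_of_mem _ (hCD hq))) le_rfl)
  refine ⟨fun t => (S t).toReal, integrable_toReal_of_lintegral_ne_top hSm hSint.ne, ?_⟩
  filter_upwards [ae_lt_top' hSm hSint.ne, ae_restrict_mem measurableSet_Ioi] with t ht htpos q hq
  -- Continuity in the row carries the bound from the countable set to its closure, hence to all of
  -- `D j`.
  have hcl : ∀ q ∈ D j ∩ closure C, f t j q ∈ Icc (-(S t).toReal) (S t).toReal := by
    intro q hq
    have hcw : ContinuousWithinAt (f t j) C q :=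
      ((hf_row t (le_of_lt htpos)) q hq.1).mono hCD
    refine closure_minimal ?_ isClosed_Icc (hcw.mem_closure_image hq.2)
    rintro _ ⟨p, hp, rfl⟩
    have : ENNReal.ofReal |f t j p| ≤ S t := le_iSup₂_of_le p hp le_rfl
    exact abs_le.1 ((ENNReal.ofReal_le_iff_le_toReal ht.ne).1 this)
  exact abs_le.2 (hcl q ⟨hq, hDC hq⟩)

theorem isCompact_controlSpace (hD : ∀ i, IsCompact (D i)) : IsCompact (controlSpace D) := by
  have : controlSpace D = Set.pi (univ : Set (Fin N)) D := by
    ext Q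
    exact ⟨fun h i _ => h i, fun h i => h i (mem_univ i)⟩
  rw [this]
  exact isCompact_univ_pi hD

theorem convex_controlSpace (hD : ∀ i, Convex ℝ (D i)) : Convex ℝ (controlSpace D) :=
  fun _ hQ _ hR _ _ ha hb hab i => hD i (hQ i) (hR i) ha hb hab

/-- Dominated convergence: transition probabilities are at most `1`, so the sum of the bounds for
the separate states dominates uniformly in `R`. -/
theorem continuousOn_payoff_const (hX : IsControlledChain D X Pc)
    (hD : ∀ i, IsCompact (D i))
    (hf_time : ∀ i, ∀ q ∈ D i, ContinuousOn (fun t => f t i q) (Ici 0))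
    (hf_row : ∀ i, ∀ t ≥ 0, ContinuousOn (f t i) (D i))
    (hf_int : IntegrabilityCondition D f) (i : Fin N) :
    ContinuousOn (fun R => payoff f X Pc i (fun _ => R)) (controlSpace D) := by
  have hf : ∀ j, ∀ q ∈ D j, IntegrableOn (fun t => f t j q) (Ioi 0) :=
    fun j q hq => hf_int.integrableOn hq (hf_time j q hq)
  have : FirstCountableTopology (Matrix (Fin N) (Fin N) ℝ) :=
    inferInstanceAs (FirstCountableTopology (Fin N → Fin N → ℝ))
  choose b hb hbd using fun j => hf_int.exists_integrable_bound (hD j) (hf_time j) (hf_row j)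
  refine ContinuousOn.congr (f := fun R => ∫ t in Ioi (0 : ℝ),
    (NormedSpace.exp (t • R) *ᵥ runningPayoff f R t) i) ?_ fun R hR => ?_
  · refine continuousOn_of_dominated (bound := fun t => ∑ j, b j t) (fun R hR => ?_)
      (fun R hR => ?_) (integrable_finsetSum _ fun j _ => hb j) ?_
    · exact ((integrableOn_exp_smul_mulVec hX hf hR).eval i).aestronglyMeasurable
    · filter_upwards [ae_all_iff.2 hbd, ae_restrict_mem measurableSet_Ioi] with t ht htpos
      simp only [Matrix.mulVec, dotProduct]
      refine (norm_sum_le _ _).trans (Finset.sum_le_sum fun j _ => ?_)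
      obtain ⟨h0, h1⟩ := exp_smul_apply_nonneg_le_one hX hR (le_of_lt htpos) i j
      rw [runningPayoff_of_nonneg (le_of_lt htpos), norm_mul, Real.norm_of_nonneg h0]
      exact (mul_le_of_le_one_left (norm_nonneg _) h1).trans (ht j _ (hR j))
    · filter_upwards [ae_restrict_mem measurableSet_Ioi] with t htpos
      simp only [Matrix.mulVec, dotProduct]
      refine continuousOn_finsetSum _ fun j _ => ContinuousOn.mul ?_ ?_
      · exact (((Matrix.continuous_exp.comp (continuous_const_smul t)).matrix_elem
          i j)).continuousOn
      · simp_rw [runningPayoff_of_nonneg (le_of_lt (mem_Ioi.1 htpos))]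
        exact (hf_row j t (le_of_lt htpos)).comp (continuous_apply j).continuousOn
          fun R hR => hR j
  · rw [congrFun (payoff_const_eq_integral hX hf hR) i,
      eval_integral fun i => (integrableOn_exp_smul_mulVec hX hf hR).eval i]

/-! ### Hamiltonian maximizers and equilibria. -/

/-- Each row of `R` maximizes the Hamiltonian of its state, for the continuation values `v`. -/
def IsHamiltonianMaximizer (D : Fin N → Set (Fin N → ℝ)) (f : ℝ → Fin N → (Fin N → ℝ) → ℝ)
    (R : Matrix (Fin N) (Fin N) ℝ) (v : Fin N → ℝ) : Prop :=
  ∀ i, ∀ q ∈ D i, f 0 i q - f 0 i (R i) + (q - R i) ⬝ᵥ v ≤ 0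

theorem exists_isHamiltonianMaximizer {V : Matrix (Fin N) (Fin N) ℝ → Fin N → ℝ}
    (hne : ∀ i, (D i).Nonempty) (hconv : ∀ i, Convex ℝ (D i)) (hcpt : ∀ i, IsCompact (D i))
    (hf_row : ∀ i, ContinuousOn (f 0 i) (D i)) (hf_concave : ∀ i, ConcaveOn ℝ (D i) (f 0 i))
    (hV : ∀ i, ContinuousOn (fun R => V R i) (controlSpace D)) :
    ∃ R ∈ controlSpace D, IsHamiltonianMaximizer D f R (V R) := by
  have key : ∃ R ∈ controlSpace D, ∀ Q ∈ controlSpace D,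
      ∑ i, (f 0 i (Q i) - f 0 i (R i) + (Q i - R i) ⬝ᵥ V R) ≤ 0 := by
    refine (isCompact_controlSpace hcpt).exists_forall_le_zero_of_concaveOn
      (φ := fun R Q => ∑ i, (f 0 i (Q i) - f 0 i (R i) + (Q i - R i) ⬝ᵥ V R))
      (by choose q hq using hne; exact ⟨q, hq⟩) (convex_controlSpace hconv) ?_ ?_ ?_
    · intro Q _
      have hrow : ∀ i, Continuous fun R : Matrix (Fin N) (Fin N) ℝ => R i := continuous_apply
      refine continuousOn_finsetSum _ fun i _ => ContinuousOn.add (continuousOn_const.sub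
        ((hf_row i).comp (hrow i).continuousOn fun R hR => hR i)) ?_
      simp only [dotProduct]
      refine continuousOn_finsetSum _ fun k _ => ContinuousOn.mul ?_ (hV k)
      exact (continuous_const.sub ((continuous_apply k).comp (hrow i))).continuousOn
    · refine fun R _ => ⟨convex_controlSpace hconv, fun Q hQ Q' hQ' a b ha hb hab => ?_⟩
      simp only [smul_eq_mul, Finset.mul_sum]
      rw [← Finset.sum_add_distrib]
      refine Finset.sum_le_sum fun i _ => ?_
      have h := (hf_concave i).2 (hQ i) (hQ' i) ha hb hab
      have h1 : (a • Q + b • Q') i = a • Q i + b • Q' i := rfl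
      simp only [smul_eq_mul] at h
      rw [h1]
      simp only [sub_dotProduct, add_dotProduct, smul_dotProduct, smul_eq_mul]
      have hb' : b = 1 - a := by linarith
      subst hb'
      linarith
    · intro R _
      simp
  obtain ⟨R, hR, hRmax⟩ := key
  refine ⟨R, hR, fun i q hq => ?_⟩
  -- Changing a single row annihilates all other summands, so the inequality for the sum yields one
  -- for each state.
  have hmem : R.updateRow i q ∈ controlSpace D := fun k => by
    rcases eq_or_ne k i with rfl | h
    · simpa using hq
    · simpa [Matrix.updateRow_ne h] using hR k
  have h := hRmax _ hmem
  rw [Finset.sum_eq_single i] at h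
  · simpa using h
  · intro k _ hk
    simp [Matrix.updateRow_ne hk]
  · simp

/-- A second maximizer `q` would make the midpoint of `q` and `R i` strictly better than both. -/
theorem IsHamiltonianMaximizer.lt_zero {v : Fin N → ℝ} (h : IsHamiltonianMaximizer D f R v)
    (hf : ∀ i, StrictConcaveOn ℝ (D i) (f 0 i)) (hR : R ∈ controlSpace D) {i : Fin N}
    {q : Fin N → ℝ} (hq : q ∈ D i) (hne : q ≠ R i) :
    f 0 i q - f 0 i (R i) + (q - R i) ⬝ᵥ v < 0 := by
  have hhalf : (0 : ℝ) < 1 / 2 := by norm_num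
  have hmem : (1 / 2 : ℝ) • q + (1 / 2 : ℝ) • R i ∈ D i :=
    (hf i).1 hq (hR i) hhalf.le hhalf.le (by norm_num)
  have h1 := (hf i).2 hq (hR i) hne hhalf hhalf (by norm_num)
  have h2 := h i _ hmem
  simp only [sub_dotProduct, add_dotProduct, smul_dotProduct, smul_eq_mul] at h1 h2 ⊢
  linarith

theorem advantage_zero_apply {v : Fin N → ℝ} (i : Fin N) :
    advantage f R Q v 0 i = -(f 0 i (Q i) - f 0 i (R i) + (Q i - R i) ⬝ᵥ v) := by
  have : ((R - Q) *ᵥ v) i = -((Q i - R i) ⬝ᵥ v) := by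
    rw [← neg_dotProduct, neg_sub]
    rfl
  simp only [advantage, Pi.add_apply, Pi.sub_apply, backwardSolution_zero,
    runningPayoff_of_nonneg le_rfl, this]
  ring

theorem advantage_apply_eq_zero {v : Fin N → ℝ} {i : Fin N} (h : Q i = R i) (t : ℝ) :
    advantage f R Q v t i = 0 := by
  have : ∀ w, ((R - Q) *ᵥ w) i = 0 := fun w => by
    have : (R - Q) i = 0 := sub_eq_zero.2 h.symm
    rw [Matrix.mulVec, this, zero_dotProduct]
  simp [advantage, this, runningPayoff, h]

theorem IsHamiltonianMaximizer.isWeakEquilibrium (hX : IsControlledChain D X Pc)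
    (hf_time : ∀ i, ∀ q ∈ D i, ContinuousOn (fun t => f t i q) (Ici 0))
    (hf : ∀ j, ∀ q ∈ D j, IntegrableOn (fun t => f t j q) (Ioi 0)) (hR : R ∈ controlSpace D)
    (h : IsHamiltonianMaximizer D f R fun k => payoff f X Pc k (fun _ => R)) :
    IsWeakEquilibrium D f X Pc R := by
  refine ⟨hR, fun Q hQ i => ?_⟩
  set v : Fin N → ℝ := fun k => payoff f X Pc k (fun _ => R)
  have hH := continuous_exp_smul_mulVec_advantage hf_time hQ hR v i
  -- Since payoffs are extended constantly to negative times, the integrand is continuous around `0`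
  -- and the fundamental theorem applies there. The quotient thus has a genuine limit, the advantage
  -- at time `0`.
  have hder := (hasDerivWithinAt_iff_tendsto_slope' (s := Ioi (0 : ℝ)) (by simp)).1
    (hH.integral_hasStrictDerivAt 0 0).hasDerivAt.hasDerivWithinAt
  have hlim : Tendsto (fun ε : ℝ => (payoff f X Pc i (fun _ => R) -
      payoff f X Pc i (concat Q ε R)) / ε) (𝓝[>] 0) (𝓝 (advantage f R Q v 0 i)) := by
    simp only [zero_smul, NormedSpace.exp_zero, Matrix.one_mulVec] at hder
    refine hder.congr' ?_
    filter_upwards [self_mem_nhdsWithin] with ε hε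
    rw [payoff_sub_payoff_concat hX hf_time hf hQ hR hε, slope_def_field]
    simp [v]
  refine le_of_le_of_eq ?_ ((continuous_coe_real_ereal.tendsto _).comp hlim).liminf_eq.symm
  rw [advantage_zero_apply]
  exact_mod_cast neg_nonneg.2 (h i _ (hQ i))

theorem IsHamiltonianMaximizer.isStrongEquilibrium (hX : IsControlledChain D X Pc)
    (hf_time : ∀ i, ∀ q ∈ D i, ContinuousOn (fun t => f t i q) (Ici 0))
    (hf : ∀ j, ∀ q ∈ D j, IntegrableOn (fun t => f t j q) (Ioi 0)) (hR : R ∈ controlSpace D)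
    (hstrict : ∀ i, StrictConcaveOn ℝ (D i) (f 0 i))
    (h : IsHamiltonianMaximizer D f R fun k => payoff f X Pc k (fun _ => R)) :
    IsStrongEquilibrium D f X Pc R := by
  refine ⟨hR, fun i Q hQ => ?_⟩
  set v : Fin N → ℝ := fun k => payoff f X Pc k (fun _ => R)
  have hadv : ∀ᶠ t in 𝓝 (0 : ℝ), ∀ j, 0 ≤ advantage f R Q v t j := by
    refine eventually_all.2 fun j => ?_
    -- Where the rows agree, positivity at time `0` is unavailable, but the advantage is identically
    -- zero; elsewhere it is positive at `0` and continuous.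
    by_cases hj : Q j = R j
    · exact Eventually.of_forall fun t => (advantage_apply_eq_zero hj t).ge
    · have hpos : 0 < advantage f R Q v 0 j := by
        rw [advantage_zero_apply]
        exact neg_pos.2 (h.lt_zero hstrict hR (hQ j) hj)
      have hc := continuous_pi_iff.1 (continuous_advantage hf_time hQ hR v) j
      exact (hc.continuousAt.eventually (lt_mem_nhds hpos)).mono fun _ => le_of_lt
  obtain ⟨δ, hδ, hball⟩ := Metric.eventually_nhds_iff.1 hadv
  refine ⟨δ / 2, half_pos hδ, fun ε hε hεδ => sub_nonneg.1 ?_⟩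
  rw [payoff_sub_payoff_concat hX hf_time hf hQ hR hε]
  refine intervalIntegral.integral_nonneg hε.le fun t ht => ?_
  simp only [Matrix.mulVec, dotProduct]
  refine Finset.sum_nonneg fun j _ => ?_
  refine mul_nonneg (exp_smul_apply_nonneg_le_one hX hQ ht.1 i j).1 (hball ?_ j)
  rw [Real.dist_0_eq_abs, abs_of_nonneg ht.1]
  linarith [ht.2]

end EquilibriumControl

theorem theorem3p3 {N : ℕ} {Ω : Type*} [MeasurableSpace Ω]
    (D : Fin N → Set (Fin N → ℝ)) (f : ℝ → Fin N → (Fin N → ℝ) → ℝ)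
    (X : ℝ → Ω → Fin N) (P : Fin N → (ℝ → Matrix (Fin N) (Fin N) ℝ) → Measure Ω)
    (hX : IsControlledChain D X P)
    (hD : ∀ i, D i ⊆ generatorRows i)
    (hD_nonempty : ∀ i, (D i).Nonempty)
    (hD_convex : ∀ i, Convex ℝ (D i))
    (hD_compact : ∀ i, IsCompact (D i))
    (hf_time : ∀ i, ∀ q ∈ D i, ContinuousOn (fun t => f t i q) (Ici 0))
    (hf_row : ∀ i, ∀ t ≥ 0, ContinuousOn (f t i) (D i))
    (hf_int : IntegrabilityCondition D f)
    (hf_concave : ∀ i, ConcaveOn ℝ (D i) (f 0 i)) :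
    (∃ Qs, IsWeakEquilibrium D f X P Qs) ∧
      ((∀ i, StrictConcaveOn ℝ (D i) (f 0 i)) → SecondOrderCondition D f →
        ∃ Qs, IsStrongEquilibrium D f X P Qs) := by
  have hf : ∀ j, ∀ q ∈ D j, IntegrableOn (fun t => f t j q) (Ioi 0) :=
    fun j q hq => hf_int.integrableOn hq (hf_time j q hq)
  obtain ⟨R, hR, hmax⟩ := exists_isHamiltonianMaximizer hD_nonempty hD_convex hD_compact
    (fun i => hf_row i 0 le_rfl) hf_concave
    (continuousOn_payoff_const hX hD_compact hf_time hf_row hf_int)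
  exact ⟨⟨R, hmax.isWeakEquilibrium hX hf_time hf hR⟩,
    fun hstrict _ => ⟨R, hmax.isStrongEquilibrium hX hf_time hf hR hstrict⟩⟩
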